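/- Let $\Omega$ be a Polish space with its Borel $\sigma$-algebra, let $C_b(\Omega)$ be the space of bounded continuous real functions on $\Omega$ with the pointwise order, and let $\mathcal L\subset C_b(\Omega)$ be a linear subspace which contains the constants, is a vector lattice, and generates the topology of $\Omega$ (the topology of $\Omega$ is the coarsest for which every $X\in\mathcal L$ is continuous). A \emph{convex risk measure} on $\mathcal L$ (or, in the same way, on $C_b(\Omega)$) is a function $\rho:\mathcal L\to\mathbb R$ such that for all $X,Y\in\mathcal L$: $\rho(X)\ge\rho(Y)$ if $X\le Y$; $\rho(tX+(1-t)Y)\le t\rho(X)+(1-t)\rho(Y)$ for $0\le t\le 1$; and $\rho(X+a)=\rho(X)-a$ for $a\in\mathbb R$. It is \emph{normalized} if $\rho(0)=0$. A normalized convex risk measure is \emph{uniformly regular} if $\sup_{\lambda>0}\rho(\lambda X)/\lambda<\infty$ for every $X$, and for every sequence $(X_n)$ in its domain decreasing pointwise to $0$, $\rho(-\lambda X_n)/\lambda\to0$ uniformly in $\lambda>0$. In that case set $\rho_{\min}(X)=\sup_{\lambda>0}\rho(\lambda X)/\lambda$ on $\mathcal L$, and let the capacity associated with $\rho$ be $c_\rho(X)=\rho_{\min}(-|X|)$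 for $X\in\mathcal L$, extended to $X\in C_b(\Omega)$ by $c_\rho(X)=\sup\{c_\rho(\varphi):\varphi\in\mathcal L,\ 0\le\varphi\le|X|\}$. \textbf{Theorem.} Let $\rho$ be a normalized, uniformly regular convex risk measure on $\mathcal L$. (i) $\rho$ has an extension, again denoted by $\rho$, to $C_b(\Omega)$ which is a uniformly regular convex risk measure and is continuous for $c_\rho$. It is the unique extension of $\rho$ to $C_b(\Omega)$ that is a convex risk measure, and also the unique extension that is continuous for $c_\rho$. For a Borel probability measure $Q$ on $\Omega$ put $\alpha(Q)=\sup_{X\in C_b(\Omega)}\bigl(E_Q[-X]-\rho(X)\bigr)\in(-\infty,+\infty]$. There is a sequence $(Q_n)_{n\in\mathbb N}$ of Borel probability measures on $\Omega$ such that $\{Q_n:n\in\mathbb N\}$ is weakly relatively compact, $\alpha(Q_n)<\infty$ for all $n$, and the following hold. (ii) For every $X\in C_b(\Omega)$, $\rho(X)=\sup_{n\in\mathbb N}\bigl(E_{Q_n}[-X]-\alpha(Q_n)\bigr)$. (iii) For all $\alpha_n>0$ with $\sum_n\alpha_n=1$, the probability measure $P=\sum_n\alpha_nQ_n$ characterizes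 the riskless nonpositive elements of $C_b(\Omega)$: for every $X\in C_b(\Omega)$ with $X\le0$, $X$ is riskless (that is, $\rho(\lambda X)=0$ for all $\lambda>0$) if and only if $X=0$ $P$-almost surely. (iv) For every $X\in C_b(\Omega)$ there is a probability measure $Q_X$ in the weak closure of $\{Q_n:n\in\mathbb N\}$ such that $\rho(X)=E_{Q_X}[-X]-\alpha(Q_X)$. -/

import Mathlib

open MeasureTheory Filter Topology Set
open scoped BoundedContinuousFunction NNReal

noncomputable section

namespace RiskMeasure

variable {Ω : Type*} [TopologicalSpace Ω]

/-- `L` is a linear subspace of `C_b(Ω)` which contains the constants, is a vector lattice for the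
pointwise order, and generates the topology of `Ω` (the topology of `Ω` is the coarsest one for
which all the elements of `L` are continuous). -/
structure IsGeneratingLattice (L : Submodule ℝ (Ω →ᵇ ℝ)) : Prop where
  const_mem : ∀ a : ℝ, BoundedContinuousFunction.const Ω a ∈ L
  sup_mem : ∀ X ∈ L, ∀ Y ∈ L, X ⊔ Y ∈ L
  inf_mem : ∀ X ∈ L, ∀ Y ∈ L, X ⊓ Y ∈ L
  generates : ‹TopologicalSpace Ω› =
    ⨅ X ∈ L, TopologicalSpace.induced (fun ω => X ω) (inferInstance : TopologicalSpace ℝ)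

/-- `ρ` is a convex risk measure on `L`. Only the values of `ρ` on `L` are constrained; the choice
`L = ⊤` gives convex risk measures on `C_b(Ω)`. -/
structure IsConvexRiskMeasureOn (L : Submodule ℝ (Ω →ᵇ ℝ)) (ρ : (Ω →ᵇ ℝ) → ℝ) : Prop where
  monotonic : ∀ X ∈ L, ∀ Y ∈ L, X ≤ Y → ρ Y ≤ ρ X
  convex : ∀ X ∈ L, ∀ Y ∈ L, ∀ t : ℝ, 0 ≤ t → t ≤ 1 →
    ρ (t • X + (1 - t) • Y) ≤ t * ρ X + (1 - t) * ρ Y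
  translation : ∀ X ∈ L, ∀ a : ℝ, ρ (X + BoundedContinuousFunction.const Ω a) = ρ X - a

/-- `ρ` is uniformly regular on `L`: `sup_{t > 0} ρ(t X) / t` is finite for every `X ∈ L`, and for
every sequence in `L` decreasing pointwise to `0`, `ρ(- t Xₙ) / t` tends to `0` uniformly in
`t > 0`. -/
structure IsUniformlyRegularOn (L : Submodule ℝ (Ω →ᵇ ℝ)) (ρ : (Ω →ᵇ ℝ) → ℝ) : Prop where
  bddAbove : ∀ X ∈ L, BddAbove ((fun t : ℝ => ρ (t • X) / t) '' Ioi 0)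
  uniform : ∀ X : ℕ → (Ω →ᵇ ℝ), (∀ n, X n ∈ L) → Antitone X →
    (∀ ω, Tendsto (fun n => X n ω) atTop (𝓝 0)) →
    TendstoUniformlyOn (fun (n : ℕ) (t : ℝ) => ρ (-(t • X n)) / t) (fun _ => 0) atTop (Ioi 0)

/-- `ρ_min(X) = sup_{t > 0} ρ(t X) / t`. -/
def rhoMin (ρ : (Ω →ᵇ ℝ) → ℝ) (X : Ω →ᵇ ℝ) : ℝ :=
  ⨆ t : Ioi (0 : ℝ), ρ ((t : ℝ) • X) / (t : ℝ)

/-- The capacity `c_ρ` canonically associated with `ρ`: it is `ρ_min(-|X|)` on `L`, and it is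
extended to a bounded continuous `X` as the supremum of its values over the `φ ∈ L` such that
`0 ≤ φ ≤ |X|`. -/
def capacity (L : Submodule ℝ (Ω →ᵇ ℝ)) (ρ : (Ω →ᵇ ℝ) → ℝ) (X : Ω →ᵇ ℝ) : ℝ :=
  ⨆ φ : {φ : Ω →ᵇ ℝ // φ ∈ L ∧ 0 ≤ φ ∧ φ ≤ |X|}, rhoMin ρ (-|φ.1|)

/-- Continuity of a function on `C_b(Ω)` for a semi-norm `c`. -/
def ContinuousFor (c : (Ω →ᵇ ℝ) → ℝ) (F : (Ω →ᵇ ℝ) → ℝ) : Prop :=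
  ∀ X : Ω →ᵇ ℝ, ∀ ε > 0, ∃ δ > 0, ∀ Y : Ω →ᵇ ℝ, c (Y - X) < δ → |F Y - F X| < ε

/-- `X ≤ 0` in `C_b(Ω)` is riskless for `ρ` if `ρ(t X) = 0` for all `t > 0`. -/
def IsRiskless (ρ : (Ω →ᵇ ℝ) → ℝ) (X : Ω →ᵇ ℝ) : Prop :=
  X ≤ 0 ∧ ∀ t : ℝ, 0 < t → ρ (t • X) = 0

variable [MeasurableSpace Ω]

/-- The penalty `α(Q) = sup_X (E_Q[-X] - ρ(X))`, with value `+∞` allowed. -/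
def penalty (ρ : (Ω →ᵇ ℝ) → ℝ) (Q : ProbabilityMeasure Ω) : EReal :=
  ⨆ X : Ω →ᵇ ℝ, (((∫ ω, -X ω ∂(Q : Measure Ω)) - ρ X : ℝ) : EReal)

/-- The measure `∑ₙ aₙ Qₙ`. -/
def mixture (a : ℕ → ℝ≥0) (Q : ℕ → ProbabilityMeasure Ω) : Measure Ω :=
  Measure.sum fun n => a n • (Q n : Measure Ω)

end RiskMeasure

end

/-!
The extension. A generating lattice `L` contains bump functions, so by the Lindelöf property every
`f ∈ C_b(Ω)` is the pointwise limit of an increasing sequence `Xₙ ≤ f` and of a decreasing sequence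
`Yₙ ≥ f` in `L`. Convexity gives `ρ(X + Z) ≤ ρ(X) + ρ_min(Z)`
(`IsConvexRiskMeasureOn.apply_add_le`), and regularity along `Yₙ - Xₙ ↓ 0` makes
`ρ(Xₙ) - ρ(Yₙ) ≤ ρ_min(-(Yₙ - Xₙ))` tend to `0`. Monotonicity therefore leaves only one possible
value at `f`, namely the infimum of `ρ` over the minorants of `f` in `L`; since moreover
`c_ρ(Xₙ - f) ≤ ρ_min(-(Yₙ - Xₙ))`, the lattice is dense for `c_ρ`, which gives the second
uniqueness statement. Uniform regularity passes to the extension because a sequence in `C_b(Ω)`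
decreasing to `0` is dominated by one in `L` (`IsGeneratingLattice.exists_antitone_majorant`).

The representation. By Hahn–Banach `ρ` has a subgradient at each `X`, dominated by `ρ_min`
(`IsConvexRiskMeasureOn.exists_subgradient`). A linear functional dominated by `ρ_min` is, up to
sign, positive, normalized and continuous along sequences decreasing to `0`, hence the expectation
of a probability measure (`exists_probabilityMeasure_integral_eq`). That version of
Daniell's theorem comes from the Riesz–Markov–Kakutani theorem on the Stone–Čech compactification, where the
completeness of `Ω` shows that the representing measure does not charge the remainder. The same
argument applied to limits along ultrafilters shows that the set of measures dominated by `ρ_min`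
is weakly compact; since the weak topology is metrizable, the graph of the penalty over this set is
separable, and the measures `Qₙ` are read off a countable dense subset of the graph. Attainment on
the closure follows from compactness and the lower semicontinuity of the penalty; the description
of riskless positions follows by letting `t` tend to infinity in `t E_{Qₙ}[-X] ≤ α(Qₙ)`.
-/

namespace RiskMeasure

variable {Ω : Type*} [TopologicalSpace Ω] {L : Submodule ℝ (Ω →ᵇ ℝ)} {ρ : (Ω →ᵇ ℝ) → ℝ}

/-! ### Approximation of bounded continuous functions by a generating lattice -/

lemma IsGeneratingLattice.abs_mem (hL : IsGeneratingLattice L) {X : Ω →ᵇ ℝ} (hX : X ∈ L) :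
    |X| ∈ L :=
  hL.sup_mem X hX (-X) (L.neg_mem hX)

lemma IsGeneratingLattice.partialSups_mem (hL : IsGeneratingLattice L) {X : ℕ → Ω →ᵇ ℝ}
    (hX : ∀ n, X n ∈ L) (n : ℕ) : partialSups X n ∈ L := by
  induction n with
  | zero => simpa using hX 0
  | succ n ih => rw [partialSups_add_one]; exact hL.sup_mem _ ih _ (hX _)

lemma IsGeneratingLattice.nhds_eq (hL : IsGeneratingLattice L) (ω : Ω) :
    𝓝 ω = ⨅ X ∈ L, comap (fun x => X x) (𝓝 (X ω)) := by
  have h := congrArg (fun t => @nhds Ω t ω) hL.generates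
  simpa only [nhds_iInf, nhds_induced] using h

/-- A generating lattice contains enough bump functions to separate points from closed sets. -/
lemma IsGeneratingLattice.exists_bump (hL : IsGeneratingLattice L) {ω : Ω} {U : Set Ω}
    (hU : U ∈ 𝓝 ω) :
    ∃ b ∈ L, 0 ≤ b ∧ (∀ x, b x ≤ 1) ∧ b ω = 1 ∧ ∀ x, x ∉ U → b x = 0 := by
  -- The sets admitting a bump form a filter, which turns out to be finer than `𝓝 ω`.
  let F : Filter Ω :=
    { sets := {U | ∃ b ∈ L, 0 ≤ b ∧ (∀ x, b x ≤ 1) ∧ b ω = 1 ∧ ∀ x, x ∉ U → b x = 0}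
      univ_sets := ⟨BoundedContinuousFunction.const Ω 1, hL.const_mem 1,
        fun x => by simp, by simp, by simp, by simp⟩
      sets_of_superset := by
        rintro U V ⟨b, hb, h0, h1, h2, h3⟩ hUV
        exact ⟨b, hb, h0, h1, h2, fun x hx => h3 x fun h => hx (hUV h)⟩
      inter_sets := by
        rintro U V ⟨b, hb, h0, h1, h2, h3⟩ ⟨c, hc, k0, k1, k2, k3⟩
        refine ⟨b ⊓ c, hL.inf_mem b hb c hc, le_inf h0 k0, fun x => ?_, ?_, fun x hx => ?_⟩
        · exact (min_le_left _ _).trans (h1 x)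
        · change min (b ω) (c ω) = 1
          rw [h2, k2, min_self]
        · change min (b x) (c x) = 0
          by_cases hxU : x ∈ U
          · rw [k3 x fun h => hx ⟨hxU, h⟩]; exact min_eq_right (h0 x)
          · rw [h3 x hxU]; exact min_eq_left (k0 x) }
  suffices hF : F ≤ 𝓝 ω from hF hU
  rw [hL.nhds_eq ω]
  refine le_iInf₂ fun X hX => ?_
  rw [(Metric.nhds_basis_ball.comap _).ge_iff]
  intro ε hε
  let C := fun a : ℝ => BoundedContinuousFunction.const Ω a
  refine ⟨(C 1 - ε⁻¹ • |X - C (X ω)|) ⊔ 0, ?_, le_sup_right, fun x => ?_, ?_, fun x hx => ?_⟩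
  · exact hL.sup_mem _ (L.sub_mem (hL.const_mem 1) (L.smul_mem _ (hL.abs_mem
      (L.sub_mem hX (hL.const_mem _))))) _ L.zero_mem
  · change max (1 - ε⁻¹ * |X x - X ω|) 0 ≤ 1
    have : 0 ≤ ε⁻¹ * |X x - X ω| := by positivity
    exact max_le (by linarith) zero_le_one
  · change max (1 - ε⁻¹ * |X ω - X ω|) 0 = 1
    simp
  · change max (1 - ε⁻¹ * |X x - X ω|) 0 = 0
    have hx' : ε ≤ |X x - X ω| := by
      simpa [Real.dist_eq] using hx
    have : 1 ≤ ε⁻¹ * |X x - X ω| := by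
      rw [inv_mul_eq_div, le_div_iff₀ hε]; linarith
    exact max_eq_right (by linarith)

/-- A bounded continuous function is the pointwise supremum of its minorants in a generating
lattice. -/
lemma IsGeneratingLattice.exists_minorant (hL : IsGeneratingLattice L) (f : Ω →ᵇ ℝ) (ω : Ω)
    {r : ℝ} (hr : r < f ω) : ∃ φ ∈ L, φ ≤ f ∧ r < φ ω := by
  obtain ⟨s, hrs, hs⟩ := exists_between hr
  have hU : {x | s < f x} ∈ 𝓝 ω := f.continuous.continuousAt.eventually (lt_mem_nhds hs)
  obtain ⟨b, hb, h0, h1, h2, h3⟩ := hL.exists_bump hU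
  have hM : ∀ x, -‖f‖ ≤ f x := fun x => (abs_le.1 (f.norm_coe_le_norm x)).1
  by_cases hsM : s ≤ -‖f‖
  · refine ⟨BoundedContinuousFunction.const Ω (-‖f‖), hL.const_mem _, hM, ?_⟩
    simp only [BoundedContinuousFunction.const_apply]; linarith
  push Not at hsM
  refine ⟨(s + ‖f‖) • b - BoundedContinuousFunction.const Ω ‖f‖,
    L.sub_mem (L.smul_mem _ hb) (hL.const_mem _), fun x => ?_, ?_⟩
  · change (s + ‖f‖) * b x - ‖f‖ ≤ f x
    by_cases hx : s < f x
    · nlinarith [h1 x]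
    · rw [h3 x hx]; linarith [hM x]
  · change r < (s + ‖f‖) * b ω - ‖f‖
    rw [h2]; linarith

/-- Every bounded continuous function is the pointwise limit of an increasing sequence of elements
of a generating lattice. The Lindelöf property reduces the supremum over all minorants to a
countable one. -/
lemma IsGeneratingLattice.exists_monotone_tendsto [SecondCountableTopology Ω]
    (hL : IsGeneratingLattice L) (f : Ω →ᵇ ℝ) :
    ∃ X : ℕ → Ω →ᵇ ℝ, (∀ n, X n ∈ L) ∧ Monotone X ∧ (∀ n, X n ≤ f) ∧
      ∀ ω, Tendsto (fun n => X n ω) atTop (𝓝 (f ω)) := by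
  let S : Set (Ω →ᵇ ℝ) := {φ | φ ∈ L ∧ φ ≤ f}
  have hcov : ∀ q : ℚ, ∃ T ⊆ S, T.Countable ∧
      ⋃ φ ∈ T, {x | (q : ℝ) < φ x} = ⋃ φ ∈ S, {x | (q : ℝ) < φ x} := fun q =>
    TopologicalSpace.isOpen_biUnion_countable S (fun φ => {x | (q : ℝ) < φ x})
      fun φ _ => isOpen_lt continuous_const φ.continuous
  choose T hTS hTc hT using hcov
  let c : Ω →ᵇ ℝ := BoundedContinuousFunction.const Ω (-‖f‖)
  have hc : c ∈ S := ⟨hL.const_mem _, fun x => (abs_le.1 (f.norm_coe_le_norm x)).1⟩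
  obtain ⟨g, hg⟩ := ((countable_iUnion hTc).insert c).exists_eq_range (insert_nonempty _ _)
  have hgS : ∀ n, g n ∈ S := fun n => by
    have : g n ∈ insert c (⋃ q, T q) := hg ▸ mem_range_self n
    rcases this with h | h
    · exact h ▸ hc
    · obtain ⟨q, hq⟩ := mem_iUnion.1 h
      exact hTS q hq
  have hle : ∀ n, partialSups g n ≤ f := fun n => partialSups_le g n f fun k _ => (hgS k).2
  refine ⟨partialSups g, hL.partialSups_mem fun n => (hgS n).1, partialSups_monotone g, hle,
    fun ω => tendsto_order.2 ⟨fun r hr => ?_, fun r hr => Eventually.of_forall fun n =>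
      (hle n ω).trans_lt hr⟩⟩
  obtain ⟨q, hrq, hq⟩ := exists_rat_btwn hr
  obtain ⟨φ, hφ, hφf, hqφ⟩ := hL.exists_minorant f ω hq
  have hmem : ω ∈ ⋃ φ ∈ T q, {x | (q : ℝ) < φ x} := by
    rw [hT q]; exact mem_biUnion (show φ ∈ S from ⟨hφ, hφf⟩) hqφ
  simp only [mem_iUnion] at hmem
  obtain ⟨ψ, hψ, hqψ⟩ := hmem
  have hψg : ψ ∈ range g := hg ▸ mem_insert_of_mem _ (mem_iUnion.2 ⟨q, hψ⟩)
  obtain ⟨n, rfl⟩ := hψg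
  filter_upwards [eventually_ge_atTop n] with m hm
  have h1 : g n ω ≤ partialSups g m ω := le_partialSups_of_le g hm ω
  have h2 : (q : ℝ) < g n ω := hqψ
  linarith

lemma IsGeneratingLattice.exists_antitone_tendsto [SecondCountableTopology Ω]
    (hL : IsGeneratingLattice L) (f : Ω →ᵇ ℝ) :
    ∃ X : ℕ → Ω →ᵇ ℝ, (∀ n, X n ∈ L) ∧ Antitone X ∧ (∀ n, f ≤ X n) ∧
      ∀ ω, Tendsto (fun n => X n ω) atTop (𝓝 (f ω)) := by
  obtain ⟨X, hXL, hX, hXf, hlim⟩ := hL.exists_monotone_tendsto (-f)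
  exact ⟨fun n => -X n, fun n => L.neg_mem (hXL n), fun m n h => neg_le_neg (hX h),
    fun n => le_neg.1 (hXf n), fun ω => by simpa using (hlim ω).neg⟩

/-- A sequence of bounded continuous functions decreasing pointwise to `0` is dominated by a
sequence in the generating lattice decreasing pointwise to `0`. -/
lemma IsGeneratingLattice.exists_antitone_majorant [SecondCountableTopology Ω]
    (hL : IsGeneratingLattice L) {f : ℕ → Ω →ᵇ ℝ} (hf : Antitone f)
    (hlim : ∀ ω, Tendsto (fun n => f n ω) atTop (𝓝 0)) :
    ∃ Z : ℕ → Ω →ᵇ ℝ, (∀ n, Z n ∈ L) ∧ Antitone Z ∧ (∀ n, f n ≤ Z n) ∧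
      ∀ ω, Tendsto (fun n => Z n ω) atTop (𝓝 0) := by
  choose Y hYL hY hfY hYlim using fun n => hL.exists_antitone_tendsto (f n)
  -- `Z k` is the diagonal minimum of `Y 0 k, …, Y k k`.
  let Z : ℕ → Ω →ᵇ ℝ := fun k => -partialSups (fun n => -Y n k) k
  have hZY : ∀ {n k}, n ≤ k → Z k ≤ Y n k := fun {n k} h => by
    have := le_partialSups_of_le (fun n => -Y n k) h
    exact neg_le.1 this
  have hle : ∀ {g : Ω →ᵇ ℝ} {k}, (∀ n ≤ k, g ≤ Y n k) → g ≤ Z k := fun {g k} h =>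
    le_neg.1 (partialSups_le _ _ _ fun n hn => neg_le_neg (h n hn))
  have hfZ : ∀ k, f k ≤ Z k := fun k => hle fun n hn => (hf hn).trans (hfY n k)
  have hf0 : ∀ k ω, 0 ≤ f k ω := fun k ω =>
    le_of_tendsto (hlim ω) ((eventually_ge_atTop k).mono fun m hm => hf hm ω)
  refine ⟨Z, fun k => L.neg_mem (hL.partialSups_mem (fun n => L.neg_mem (hYL n k)) k),
    fun j k h => hle fun n hn => (hZY (hn.trans h)).trans (hY n h), hfZ, fun ω => ?_⟩
  refine tendsto_order.2 ⟨fun r hr => Eventually.of_forall fun k =>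
    hr.trans_le ((hf0 k ω).trans (hfZ k ω)), fun r hr => ?_⟩
  obtain ⟨n, hn⟩ := ((hlim ω).eventually (gt_mem_nhds hr)).exists
  filter_upwards [(hYlim n ω).eventually (gt_mem_nhds hn), eventually_ge_atTop n] with k hk hnk
  exact (hZY hnk ω).trans_lt hk

/-! ### Convex risk measures and their sublinear majorant -/

lemma const_mem_top (a : ℝ) :
    BoundedContinuousFunction.const Ω a ∈ (⊤ : Submodule ℝ (Ω →ᵇ ℝ)) := trivial

lemma neg_const_norm_le (f : Ω →ᵇ ℝ) : BoundedContinuousFunction.const Ω (-‖f‖) ≤ f :=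
  fun x => (abs_le.1 (f.norm_coe_le_norm x)).1

lemma le_const_norm (f : Ω →ᵇ ℝ) : f ≤ BoundedContinuousFunction.const Ω ‖f‖ :=
  fun x => (abs_le.1 (f.norm_coe_le_norm x)).2

namespace IsConvexRiskMeasureOn

section

variable (hρ : IsConvexRiskMeasureOn L ρ) (hc : ∀ a, BoundedContinuousFunction.const Ω a ∈ L)
include hρ hc

lemma le_add_norm_sub {X Y : Ω →ᵇ ℝ} (hX : X ∈ L) (hY : Y ∈ L) : ρ X ≤ ρ Y + ‖X - Y‖ := by
  have h := hρ.monotonic (Y + BoundedContinuousFunction.const Ω (-‖X - Y‖))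
    (L.add_mem hY (hc _)) X hX ?_
  · rw [hρ.translation Y hY] at h; linarith
  · simpa using add_le_add_right (neg_const_norm_le (X - Y)) Y

lemma abs_sub_le_norm {X Y : Ω →ᵇ ℝ} (hX : X ∈ L) (hY : Y ∈ L) : |ρ X - ρ Y| ≤ ‖X - Y‖ := by
  have h1 := hρ.le_add_norm_sub hc hX hY
  have h2 := hρ.le_add_norm_sub hc hY hX
  rw [norm_sub_rev] at h2
  exact abs_sub_le_iff.2 ⟨by linarith, by linarith⟩

variable (h0 : ρ 0 = 0)
include h0

lemma apply_smul_div_le_norm {X : Ω →ᵇ ℝ} (hX : X ∈ L) {t : ℝ} (ht : 0 < t) :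
    ρ (t • X) / t ≤ ‖X‖ := by
  have h := hρ.le_add_norm_sub hc (L.smul_mem t hX) L.zero_mem
  rw [h0, zero_add, sub_zero, norm_smul, Real.norm_of_nonneg ht.le] at h
  rwa [div_le_iff₀' ht]

lemma smul_div_le_rhoMin {X : Ω →ᵇ ℝ} (hX : X ∈ L) {t : ℝ} (ht : 0 < t) :
    ρ (t • X) / t ≤ rhoMin ρ X := by
  refine le_ciSup (f := fun t : Ioi (0 : ℝ) => ρ ((t : ℝ) • X) / (t : ℝ)) ⟨‖X‖, ?_⟩ ⟨t, ht⟩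
  rintro _ ⟨s, rfl⟩
  exact hρ.apply_smul_div_le_norm hc h0 hX s.2

lemma smul_le_mul_rhoMin {X : Ω →ᵇ ℝ} (hX : X ∈ L) {t : ℝ} (ht : 0 < t) :
    ρ (t • X) ≤ t * rhoMin ρ X :=
  (div_le_iff₀' ht).1 (hρ.smul_div_le_rhoMin hc h0 hX ht)

lemma rhoMin_antitone {X Y : Ω →ᵇ ℝ} (hX : X ∈ L) (hY : Y ∈ L) (h : X ≤ Y) :
    rhoMin ρ Y ≤ rhoMin ρ X := by
  have : Nonempty (Ioi (0 : ℝ)) := nonempty_Ioi.to_subtype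
  refine ciSup_le fun t => le_trans ?_ (hρ.smul_div_le_rhoMin hc h0 hX t.2)
  have ht : (0 : ℝ) < t := t.2
  gcongr
  refine hρ.monotonic _ (L.smul_mem _ hX) _ (L.smul_mem _ hY) fun x => ?_
  exact mul_le_mul_of_nonneg_left (h x) ht.le

omit hρ hc in
lemma rhoMin_zero : rhoMin ρ 0 = 0 := by
  have : Nonempty (Ioi (0 : ℝ)) := nonempty_Ioi.to_subtype
  simp [rhoMin, h0]

lemma rhoMin_nonneg {X : Ω →ᵇ ℝ} (hX : X ∈ L) (h : X ≤ 0) : 0 ≤ rhoMin ρ X :=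
  (rhoMin_zero h0).symm.le.trans (hρ.rhoMin_antitone hc h0 hX L.zero_mem h)

lemma rhoMin_add_le {X Z : Ω →ᵇ ℝ} (hX : X ∈ L) (hZ : Z ∈ L) :
    rhoMin ρ (X + Z) ≤ rhoMin ρ X + rhoMin ρ Z := by
  have : Nonempty (Ioi (0 : ℝ)) := nonempty_Ioi.to_subtype
  refine ciSup_le fun t => ?_
  have ht : (0 : ℝ) < t := t.2
  have h := hρ.convex _ (L.smul_mem (2 * t : ℝ) hX) _ (L.smul_mem (2 * t : ℝ) hZ) (1 / 2)
    (by norm_num) (by norm_num)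
  have h1 := hρ.smul_le_mul_rhoMin hc h0 hX (t := 2 * t) (by positivity)
  have h2 := hρ.smul_le_mul_rhoMin hc h0 hZ (t := 2 * t) (by positivity)
  have h3 : (1 / 2 : ℝ) • (2 * t : ℝ) • X + (1 - 1 / 2 : ℝ) • (2 * t : ℝ) • Z
      = (t : ℝ) • (X + Z) := by
    ext x
    change (1 / 2 : ℝ) * (2 * t * X x) + (1 - 1 / 2) * (2 * t * Z x) = t * (X x + Z x)
    ring
  rw [h3] at h
  rw [div_le_iff₀' ht]
  linarith

/-- A normalized convex risk measure grows at most as fast as its sublinear majorant: write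
`X + Z` as a convex combination of `X / (1 - t)` and `Z / t` and let `t` tend to `0`. -/
lemma apply_add_le {X Z : Ω →ᵇ ℝ} (hX : X ∈ L) (hZ : Z ∈ L) : ρ (X + Z) ≤ ρ X + rhoMin ρ Z := by
  have key : ∀ t ∈ Ioo (0 : ℝ) 1, ρ (X + Z) ≤ ρ X + rhoMin ρ Z + t * (‖X‖ + |ρ X|) := by
    rintro t ⟨ht0, ht1⟩
    have hs : 0 < 1 - t := by linarith
    have h := hρ.convex _ (L.smul_mem t⁻¹ hZ) _ (L.smul_mem (1 - t)⁻¹ hX) t ht0.le ht1.le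
    rw [smul_inv_smul₀ ht0.ne', smul_inv_smul₀ hs.ne', add_comm] at h
    have h1 := hρ.smul_le_mul_rhoMin hc h0 hZ (inv_pos.2 ht0)
    have h2 := hρ.le_add_norm_sub hc (L.smul_mem (1 - t)⁻¹ hX) hX
    have h3 : (1 - t)⁻¹ • X - X = (t * (1 - t)⁻¹) • X := by
      ext x
      change (1 - t)⁻¹ * X x - X x = t * (1 - t)⁻¹ * X x
      field_simp
      ring
    rw [h3, norm_smul, Real.norm_of_nonneg (by positivity)] at h2
    have h4 : t * ρ (t⁻¹ • Z) ≤ rhoMin ρ Z := by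
      calc t * ρ (t⁻¹ • Z) ≤ t * (t⁻¹ * rhoMin ρ Z) := by gcongr
        _ = rhoMin ρ Z := by field_simp
    have h5 : (1 - t) * ρ ((1 - t)⁻¹ • X) ≤ (1 - t) * ρ X + t * ‖X‖ := by
      calc (1 - t) * ρ ((1 - t)⁻¹ • X) ≤ (1 - t) * (ρ X + t * (1 - t)⁻¹ * ‖X‖) := by gcongr
        _ = (1 - t) * ρ X + t * ‖X‖ := by field_simp
    nlinarith [neg_abs_le (ρ X)]
  have hlim : Tendsto (fun t : ℝ => ρ X + rhoMin ρ Z + t * (‖X‖ + |ρ X|)) (𝓝[>] 0)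
      (𝓝 (ρ X + rhoMin ρ Z + 0 * (‖X‖ + |ρ X|))) :=
    (by fun_prop : Continuous fun t : ℝ => ρ X + rhoMin ρ Z + t * (‖X‖ + |ρ X|)).continuousAt.mono_left
      nhdsWithin_le_nhds
  rw [zero_mul, add_zero] at hlim
  exact ge_of_tendsto hlim (Filter.mem_of_superset (Ioo_mem_nhdsGT one_pos) key)

end

/-- On all of `C_b(Ω)` a normalized convex risk measure is Lipschitz for the semi-norm
`X ↦ ρ_min(-|X|)`. -/
lemma abs_sub_le_rhoMin (hρ : IsConvexRiskMeasureOn ⊤ ρ) (h0 : ρ 0 = 0) (X Y : Ω →ᵇ ℝ) :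
    |ρ Y - ρ X| ≤ rhoMin ρ (-|Y - X|) := by
  have hc := const_mem_top (Ω := Ω)
  have h1 := hρ.apply_add_le hc h0 (X := X) (Z := Y - X) trivial trivial
  have h2 := hρ.apply_add_le hc h0 (X := Y) (Z := X - Y) trivial trivial
  have h3 := hρ.rhoMin_antitone hc h0 (X := -|Y - X|) (Y := Y - X) trivial trivial
    fun x => neg_abs_le ((Y - X) x)
  have h4 := hρ.rhoMin_antitone hc h0 (X := -|Y - X|) (Y := X - Y) trivial trivial
    (by rw [abs_sub_comm]; exact fun x => neg_abs_le ((X - Y) x))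
  rw [add_sub_cancel] at h1 h2
  exact abs_sub_le_iff.2 ⟨by linarith, by linarith⟩

end IsConvexRiskMeasureOn

lemma IsUniformlyRegularOn.tendsto_rhoMin (hρ : IsConvexRiskMeasureOn L ρ)
    (hc : ∀ a, BoundedContinuousFunction.const Ω a ∈ L) (h0 : ρ 0 = 0)
    (hreg : IsUniformlyRegularOn L ρ) {X : ℕ → Ω →ᵇ ℝ} (hXL : ∀ n, X n ∈ L) (hX : Antitone X)
    (hlim : ∀ ω, Tendsto (fun n => X n ω) atTop (𝓝 0)) :
    Tendsto (fun n => rhoMin ρ (-X n)) atTop (𝓝 0) := by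
  have : Nonempty (Ioi (0 : ℝ)) := nonempty_Ioi.to_subtype
  have hX0 : ∀ n, -X n ≤ 0 := fun n ω => by
    change -(X n ω) ≤ 0
    exact neg_nonpos.2 (le_of_tendsto (hlim ω)
      ((eventually_ge_atTop n).mono fun m hm => hX hm ω))
  refine Metric.tendsto_atTop'.2 fun ε hε => ?_
  have hu := Metric.tendstoUniformlyOn_iff.1 (hreg.uniform X hXL hX hlim) (ε / 2) (half_pos hε)
  obtain ⟨N, hN⟩ := eventually_atTop.1 hu
  refine ⟨N, fun n hn => ?_⟩
  rw [Real.dist_eq, sub_zero, abs_of_nonneg (hρ.rhoMin_nonneg hc h0 (L.neg_mem (hXL n)) (hX0 n))]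
  refine lt_of_le_of_lt (ciSup_le fun t => ?_) (half_lt_self hε)
  have h := hN n hn.le t t.2
  have hneg : (t : ℝ) • -X n = -((t : ℝ) • X n) := by
    ext x
    exact mul_neg _ _
  rw [Real.dist_eq, zero_sub, abs_neg, ← hneg] at h
  exact (le_abs_self _).trans h.le

/-! ### The extension to all bounded continuous functions -/

/-- The extension of `ρ` by inner approximation: the infimum of `ρ` over the minorants in `L`.
For a convex risk measure and `L` containing the constants, the set of these values is nonempty and
bounded below by `ρ ‖f‖`, so the infimum is a genuine one. -/
noncomputable def extension (L : Submodule ℝ (Ω →ᵇ ℝ)) (ρ : (Ω →ᵇ ℝ) → ℝ) (f : Ω →ᵇ ℝ) : ℝ :=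
  sInf (ρ '' {X | X ∈ L ∧ X ≤ f})

section

variable (hρ : IsConvexRiskMeasureOn L ρ) (hc : ∀ a, BoundedContinuousFunction.const Ω a ∈ L)
include hρ hc

lemma extension_le {X f : Ω →ᵇ ℝ} (hX : X ∈ L) (h : X ≤ f) : extension L ρ f ≤ ρ X := by
  refine csInf_le ⟨ρ (BoundedContinuousFunction.const Ω ‖f‖), ?_⟩ ⟨X, ⟨hX, h⟩, rfl⟩
  rintro _ ⟨Y, ⟨hY, hYf⟩, rfl⟩
  exact hρ.monotonic _ hY _ (hc _) (hYf.trans (le_const_norm f))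

omit hρ in
lemma le_extension {f : Ω →ᵇ ℝ} {r : ℝ} (h : ∀ X ∈ L, X ≤ f → r ≤ ρ X) :
    r ≤ extension L ρ f := by
  refine le_csInf ⟨_, ⟨BoundedContinuousFunction.const Ω (-‖f‖), ⟨hc _, neg_const_norm_le f⟩,
    rfl⟩⟩ ?_
  rintro _ ⟨X, ⟨hX, hXf⟩, rfl⟩
  exact h X hX hXf

omit hρ in
lemma exists_lt_of_extension_lt {f : Ω →ᵇ ℝ} {r : ℝ} (h : extension L ρ f < r) :
    ∃ X ∈ L, X ≤ f ∧ ρ X < r := by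
  by_contra! H
  exact (le_extension hc H).not_gt h

lemma extension_eqOn : EqOn (extension L ρ) ρ L := fun X hX =>
  (extension_le hρ hc hX le_rfl).antisymm
    (le_extension hc fun Y hY hYX => hρ.monotonic Y hY X hX hYX)

lemma isConvexRiskMeasureOn_extension : IsConvexRiskMeasureOn ⊤ (extension L ρ) where
  monotonic X _ Y _ h := le_extension hc fun Z hZ hZX => extension_le hρ hc hZ (hZX.trans h)
  convex X _ Y _ t ht0 ht1 := by
    refine le_of_forall_pos_lt_add fun ε hε => ?_
    obtain ⟨X', hX', hXX, hXε⟩ := exists_lt_of_extension_lt hc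
      (lt_add_of_pos_right (extension L ρ X) hε)
    obtain ⟨Y', hY', hYY, hYε⟩ := exists_lt_of_extension_lt hc
      (lt_add_of_pos_right (extension L ρ Y) hε)
    have h1 : extension L ρ (t • X + (1 - t) • Y) ≤ ρ (t • X' + (1 - t) • Y') :=
      extension_le hρ hc (L.add_mem (L.smul_mem _ hX') (L.smul_mem _ hY')) fun x =>
        add_le_add (mul_le_mul_of_nonneg_left (hXX x) ht0)
          (mul_le_mul_of_nonneg_left (hYY x) (sub_nonneg.2 ht1))
    have h2 := hρ.convex X' hX' Y' hY' t ht0 ht1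
    rcases ht0.eq_or_lt with rfl | ht0
    · linarith
    · nlinarith [mul_lt_mul_of_pos_left hXε ht0,
        mul_le_mul_of_nonneg_left hYε.le (sub_nonneg.2 ht1)]
  translation X _ a := by
    refine le_antisymm ?_ ?_
    · rw [le_sub_iff_add_le]
      refine le_extension hc fun Y hY hYX => ?_
      have := extension_le hρ hc (L.add_mem hY (hc a)) (add_le_add_left hYX _)
      rw [hρ.translation Y hY a] at this
      linarith
    · refine le_extension hc fun Y hY hYX => ?_
      have := extension_le hρ hc (X := Y + BoundedContinuousFunction.const Ω (-a)) (f := X)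
        (L.add_mem hY (hc _)) fun x => ?_
      · rw [hρ.translation Y hY] at this; linarith
      · have := hYX x
        change Y x ≤ X x + a at this
        change Y x + -a ≤ X x
        linarith

end

section

variable [SecondCountableTopology Ω] (hL : IsGeneratingLattice L)
  (hρ : IsConvexRiskMeasureOn L ρ) (h0 : ρ 0 = 0) (hreg : IsUniformlyRegularOn L ρ)
include hL hρ h0 hreg

omit [SecondCountableTopology Ω] hreg in
lemma extension_zero : extension L ρ 0 = 0 := by
  rw [extension_eqOn hρ hL.const_mem L.zero_mem, h0]

lemma isUniformlyRegularOn_extension : IsUniformlyRegularOn ⊤ (extension L ρ) where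
  bddAbove X _ := by
    refine ⟨‖X‖, ?_⟩
    rintro _ ⟨t, ht, rfl⟩
    exact (isConvexRiskMeasureOn_extension hρ hL.const_mem).apply_smul_div_le_norm
      const_mem_top (extension_zero hL hρ h0) trivial ht
  uniform f _ hf hlim := by
    obtain ⟨Z, hZL, hZ, hfZ, hZlim⟩ := hL.exists_antitone_majorant hf hlim
    have hρ' := isConvexRiskMeasureOn_extension hρ hL.const_mem
    have hf0 : ∀ n ω, 0 ≤ f n ω := fun n ω =>
      le_of_tendsto (hlim ω) ((eventually_ge_atTop n).mono fun m hm => hf hm ω)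
    refine Metric.tendstoUniformlyOn_iff.2 fun ε hε => ?_
    filter_upwards [Metric.tendstoUniformlyOn_iff.1 (hreg.uniform Z hZL hZ hZlim) ε hε]
      with n hn t ht
    have ht' : (0 : ℝ) < t := ht
    have h1 : extension L ρ (-(t • f n)) ≤ ρ (-(t • Z n)) :=
      extension_le hρ hL.const_mem (L.neg_mem (L.smul_mem t (hZL n))) fun x =>
        neg_le_neg (mul_le_mul_of_nonneg_left (hfZ n x) ht'.le)
    have h2 : 0 ≤ extension L ρ (-(t • f n)) := by
      rw [← extension_zero hL hρ h0]
      exact hρ'.monotonic _ trivial _ trivial fun x => neg_nonpos.2 (mul_nonneg ht'.le (hf0 n x))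
    have h3 := hn t ht
    rw [Real.dist_eq, zero_sub, abs_neg] at h3 ⊢
    rw [abs_of_nonneg (by positivity)]
    refine lt_of_le_of_lt ?_ ((le_abs_self _).trans_lt h3)
    gcongr

omit [SecondCountableTopology Ω] hreg in
lemma rhoMin_le_capacity {φ X : Ω →ᵇ ℝ} (hφ : φ ∈ L) (hφ0 : 0 ≤ φ) (hφX : φ ≤ |X|) :
    rhoMin ρ (-φ) ≤ capacity L ρ X := by
  have hbdd : BddAbove (range fun φ : {φ : Ω →ᵇ ℝ // φ ∈ L ∧ 0 ≤ φ ∧ φ ≤ |X|} =>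
      rhoMin ρ (-|φ.1|)) := by
    refine ⟨rhoMin ρ (BoundedContinuousFunction.const Ω (-‖(|X|)‖)), ?_⟩
    rintro _ ⟨⟨ψ, hψ, hψ0, hψX⟩, rfl⟩
    refine hρ.rhoMin_antitone hL.const_mem h0 (hL.const_mem _) (L.neg_mem (hL.abs_mem hψ)) ?_
    rw [abs_of_nonneg hψ0]
    intro x
    have := (hψX.trans (le_const_norm |X|)) x
    change ψ x ≤ ‖(|X|)‖ at this
    change -‖(|X|)‖ ≤ -(ψ x)
    linarith
  have := le_ciSup hbdd ⟨φ, hφ, hφ0, hφX⟩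
  rwa [abs_of_nonneg hφ0] at this

omit [SecondCountableTopology Ω] hreg in
lemma capacity_le_rhoMin {X Z : Ω →ᵇ ℝ} (hZ : Z ∈ L) (h : |X| ≤ Z) :
    capacity L ρ X ≤ rhoMin ρ (-Z) := by
  have : Nonempty {φ : Ω →ᵇ ℝ // φ ∈ L ∧ 0 ≤ φ ∧ φ ≤ |X|} :=
    ⟨0, L.zero_mem, le_rfl, abs_nonneg X⟩
  refine ciSup_le fun φ => hρ.rhoMin_antitone hL.const_mem h0 (L.neg_mem hZ)
    (L.neg_mem (hL.abs_mem φ.2.1)) (neg_le_neg ?_)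
  rw [abs_of_nonneg φ.2.2.1]
  exact φ.2.2.2.trans h

/-- On all of `C_b(Ω)` the sublinear majorant of the extension is controlled by the capacity. -/
lemma rhoMin_extension_le_capacity (X : Ω →ᵇ ℝ) :
    rhoMin (extension L ρ) (-|X|) ≤ capacity L ρ X := by
  have hρ' := isConvexRiskMeasureOn_extension hρ hL.const_mem
  have h0' := extension_zero hL hρ h0
  have hct := const_mem_top (Ω := Ω)
  obtain ⟨φ, hφL, hφ, hφX, hlim⟩ := hL.exists_monotone_tendsto |X|
  have hlim' := (isUniformlyRegularOn_extension hL hρ h0 hreg).tendsto_rhoMin hρ' hct h0'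
    (X := fun n => |X| - φ n ⊔ 0) (fun _ => trivial)
    (fun m n h => sub_le_sub_left (sup_le_sup_right (hφ h) 0) _) fun ω => by
      have h : Tendsto (fun n => |X ω| - max (φ n ω) 0) atTop (𝓝 (|X ω| - max |X ω| 0)) :=
        ((hlim ω).max tendsto_const_nhds).const_sub _
      simpa using h
  refine ge_of_tendsto' (by simpa only [add_zero] using hlim'.const_add (capacity L ρ X)) fun n => ?_
  have hψ : φ n ⊔ 0 ∈ L := hL.sup_mem _ (hφL n) _ L.zero_mem
  have h1 := hρ'.rhoMin_add_le hct h0' (X := -(φ n ⊔ 0)) (Z := -(|X| - φ n ⊔ 0)) trivial trivial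
  have h2 : rhoMin (extension L ρ) (-(φ n ⊔ 0)) = rhoMin ρ (-(φ n ⊔ 0)) := by
    refine iSup_congr fun t => ?_
    rw [extension_eqOn hρ hL.const_mem (L.smul_mem _ (L.neg_mem hψ))]
  have h3 := rhoMin_le_capacity hL hρ h0 hψ le_sup_right
    (sup_le (hφX n) (abs_nonneg X))
  rw [← neg_add, add_sub_cancel] at h1
  linarith

lemma continuousFor_extension : ContinuousFor (capacity L ρ) (extension L ρ) := fun X ε hε =>
  ⟨ε, hε, fun Y hY =>
    ((isConvexRiskMeasureOn_extension hρ hL.const_mem).abs_sub_le_rhoMin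
      (extension_zero hL hρ h0) X Y).trans_lt
      ((rhoMin_extension_le_capacity hL hρ h0 hreg _).trans_lt hY)⟩

/-- Two-sided approximation by the lattice: its error is small for the capacity. -/
lemma exists_tendsto_rhoMin_sub (f : Ω →ᵇ ℝ) :
    ∃ X Y : ℕ → Ω →ᵇ ℝ, (∀ n, X n ∈ L) ∧ (∀ n, Y n ∈ L) ∧ (∀ n, X n ≤ f) ∧ (∀ n, f ≤ Y n) ∧
      Tendsto (fun n => rhoMin ρ (-(Y n - X n))) atTop (𝓝 0) := by
  obtain ⟨X, hXL, hX, hXf, hXlim⟩ := hL.exists_monotone_tendsto f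
  obtain ⟨Y, hYL, hY, hYf, hYlim⟩ := hL.exists_antitone_tendsto f
  exact ⟨X, Y, hXL, hYL, hXf, hYf, hreg.tendsto_rhoMin hρ hL.const_mem h0
    (fun n => L.sub_mem (hYL n) (hXL n)) (fun m n h => sub_le_sub (hY h) (hX h))
    fun ω => by simpa using (hYlim ω).sub (hXlim ω)⟩

/-- A monotone extension is determined by the approximation from both sides. -/
lemma eq_of_isConvexRiskMeasureOn {σ τ : (Ω →ᵇ ℝ) → ℝ} (hσ : IsConvexRiskMeasureOn ⊤ σ)
    (hτ : IsConvexRiskMeasureOn ⊤ τ) (hσL : EqOn σ ρ L) (hτL : EqOn τ ρ L) : σ = τ := by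
  funext f
  obtain ⟨X, Y, hXL, hYL, hXf, hYf, hlim⟩ := exists_tendsto_rhoMin_sub hL hρ h0 hreg f
  refine eq_of_abs_sub_nonpos (ge_of_tendsto' hlim fun n => ?_)
  have h := hρ.apply_add_le hL.const_mem h0 (hYL n) (L.neg_mem (L.sub_mem (hYL n) (hXL n)))
  rw [neg_sub, add_sub_cancel] at h
  have h1 := hσ.monotonic _ trivial _ trivial (hXf n)
  have h2 := hσ.monotonic _ trivial _ trivial (hYf n)
  have h3 := hτ.monotonic _ trivial _ trivial (hXf n)
  have h4 := hτ.monotonic _ trivial _ trivial (hYf n)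
  rw [hσL (hXL n)] at h1
  rw [hσL (hYL n)] at h2
  rw [hτL (hXL n)] at h3
  rw [hτL (hYL n)] at h4
  rw [neg_sub]
  exact abs_sub_le_iff.2 ⟨by linarith, by linarith⟩

/-- An extension which is continuous for the capacity is determined by density of `L`. -/
lemma eq_of_continuousFor {σ τ : (Ω →ᵇ ℝ) → ℝ} (hσ : ContinuousFor (capacity L ρ) σ)
    (hτ : ContinuousFor (capacity L ρ) τ) (hσL : EqOn σ ρ L) (hτL : EqOn τ ρ L) : σ = τ := by
  funext f
  obtain ⟨X, Y, hXL, hYL, hXf, hYf, hlim⟩ := exists_tendsto_rhoMin_sub hL hρ h0 hreg f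
  refine eq_of_forall_dist_le fun ε hε => ?_
  obtain ⟨δ, hδ, hσδ⟩ := hσ f (ε / 2) (half_pos hε)
  obtain ⟨η, hη, hτη⟩ := hτ f (ε / 2) (half_pos hε)
  obtain ⟨n, hn⟩ := (hlim.eventually (gt_mem_nhds (lt_min hδ hη))).exists
  have hcap : capacity L ρ (X n - f) ≤ rhoMin ρ (-(Y n - X n)) := by
    refine capacity_le_rhoMin hL hρ h0 (L.sub_mem (hYL n) (hXL n)) fun x => ?_
    have h1 := hXf n x
    have h2 := hYf n x
    change |X n x - f x| ≤ Y n x - X n x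
    change X n x ≤ f x at h1
    change f x ≤ Y n x at h2
    rw [abs_of_nonpos (by linarith)]
    linarith
  have h1 := abs_lt.1 (hσδ _ (hcap.trans_lt (hn.trans_le (min_le_left _ _))))
  have h2 := abs_lt.1 (hτη _ (hcap.trans_lt (hn.trans_le (min_le_right _ _))))
  rw [hσL (hXL n)] at h1
  rw [hτL (hXL n)] at h2
  rw [Real.dist_eq]
  exact abs_sub_le_iff.2 ⟨by linarith, by linarith⟩

end

end RiskMeasure

namespace RiskMeasure

/-! ### Daniell continuity and integral representation -/

section

variable {Ω : Type*} [MetricSpace Ω]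

/-- The distance to the first `N + 1` points of the sequence `x`, scaled by `m + 1` and truncated
at `1`. -/
noncomputable def truncatedDist (x : ℕ → Ω) (m N : ℕ) : Ω →ᵇ ℝ :=
  BoundedContinuousFunction.ofNormedAddCommGroup
    (fun ω => min 1 ((m + 1) * Metric.infDist ω (x '' Iic N)))
    (by have := Metric.continuous_infDist_pt (x '' Iic N); fun_prop) 1 fun ω => by
      have h : 0 ≤ min 1 (((m : ℝ) + 1) * Metric.infDist ω (x '' Iic N)) :=
        le_min zero_le_one (mul_nonneg (by positivity) Metric.infDist_nonneg)
      rw [Real.norm_of_nonneg h]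
      exact min_le_left _ _

lemma truncatedDist_apply (x : ℕ → Ω) (m N : ℕ) (ω : Ω) :
    truncatedDist x m N ω = min 1 ((m + 1) * Metric.infDist ω (x '' Iic N)) := rfl

lemma truncatedDist_nonneg (x : ℕ → Ω) (m N : ℕ) (ω : Ω) : 0 ≤ truncatedDist x m N ω :=
  le_min zero_le_one (mul_nonneg (by positivity) Metric.infDist_nonneg)

lemma truncatedDist_antitone (x : ℕ → Ω) (m : ℕ) : Antitone (truncatedDist x m) := by
  intro N N' h ω
  refine min_le_min le_rfl (mul_le_mul_of_nonneg_left ?_ (by positivity))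
  exact Metric.infDist_le_infDist_of_subset (image_mono (Iic_subset_Iic.2 h))
    (nonempty_Iic.image _)

lemma tendsto_truncatedDist {x : ℕ → Ω} (hx : DenseRange x) (m : ℕ) (ω : Ω) :
    Tendsto (fun N => truncatedDist x m N ω) atTop (𝓝 0) := by
  rw [Metric.tendsto_atTop]
  intro r hr
  have hm : (0 : ℝ) < m + 1 := by positivity
  obtain ⟨k, hk⟩ := hx.exists_dist_lt ω (div_pos hr hm)
  refine ⟨k, fun N hN => ?_⟩
  have hmem : x k ∈ x '' Iic N := ⟨k, hN, rfl⟩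
  have h : Metric.infDist ω (x '' Iic N) < r / (m + 1) :=
    (Metric.infDist_le_dist_of_mem hmem).trans_lt hk
  rw [Real.dist_eq, sub_zero, abs_of_nonneg (truncatedDist_nonneg x m N ω), truncatedDist_apply]
  rw [lt_div_iff₀' hm] at h
  exact (min_le_right _ _).trans_lt h

lemma exists_dist_lt_of_truncatedDist_lt_one {x : ℕ → Ω} {m N : ℕ} {ω : Ω}
    (h : truncatedDist x m N ω < 1) : ∃ i ≤ N, dist ω (x i) < 1 / (m + 1) := by
  rw [truncatedDist_apply, min_lt_iff] at h
  have h' := (lt_div_iff₀' (by positivity : (0 : ℝ) < m + 1)).2 (h.resolve_left (lt_irrefl _))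
  obtain ⟨_, ⟨i, hi, rfl⟩, hd⟩ := (Metric.infDist_lt_iff (nonempty_Iic.image _)).1 h'
  exact ⟨i, hi, hd⟩

end

section

variable {Ω : Type*} [TopologicalSpace Ω]

/-- The continuous extension of a bounded continuous function to the Stone-Čech
compactification. -/
lemma exists_stoneCech_extension (f : Ω →ᵇ ℝ) :
    ∃ g : C(StoneCech Ω, ℝ), ∀ ω, g (stoneCechUnit ω) = f ω := by
  have hmem : ∀ ω, f ω ∈ Icc (-‖f‖) ‖f‖ := fun ω => abs_le.1 (f.norm_coe_le_norm ω)
  have hc : Continuous fun ω => (⟨f ω, hmem ω⟩ : Icc (-‖f‖) ‖f‖) := f.continuous.subtype_mk hmem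
  exact ⟨⟨fun z => (stoneCechExtend hc z).1,
    continuous_subtype_val.comp (continuous_stoneCechExtend hc)⟩,
    fun ω => congrArg Subtype.val (stoneCechExtend_stoneCechUnit hc ω)⟩

lemma stoneCech_le_of_le {f g : C(StoneCech Ω, ℝ)}
    (h : ∀ ω, f (stoneCechUnit ω) ≤ g (stoneCechUnit ω)) (z : StoneCech Ω) : f z ≤ g z :=
  (isClosed_le f.continuous g.continuous).closure_subset_iff.2
    (range_subset_iff.2 h) (denseRange_stoneCechUnit z)

end

variable {Ω : Type*} [TopologicalSpace Ω] [PolishSpace Ω]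

/-- A Polish space is cut out of its Stone-Čech compactification by a sequence of families of
functions decreasing to `0` on the space: a point where each family drops below `1` is the limit of
a Cauchy ultrafilter. -/
lemma exists_stoneCech_range_eq [Nonempty Ω] :
    ∃ F : ℕ → ℕ → Ω →ᵇ ℝ, (∀ m, Antitone (F m)) ∧
      (∀ m ω, Tendsto (fun N => F m N ω) atTop (𝓝 0)) ∧ (∀ m N, 0 ≤ F m N) ∧
      ∀ G : ℕ → ℕ → C(StoneCech Ω, ℝ), (∀ m N ω, G m N (stoneCechUnit ω) = F m N ω) →
        range (stoneCechUnit : Ω → StoneCech Ω) = ⋂ m, ⋃ N, {z | G m N z < 1} := by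
  let := TopologicalSpace.upgradeIsCompletelyMetrizable Ω
  let x := TopologicalSpace.denseSeq Ω
  have hx : DenseRange x := TopologicalSpace.denseRange_denseSeq Ω
  refine ⟨truncatedDist x, truncatedDist_antitone x, tendsto_truncatedDist hx,
    fun m N => truncatedDist_nonneg x m N, fun G hG => Subset.antisymm ?_ fun z hz => ?_⟩
  · rintro _ ⟨ω, rfl⟩
    refine mem_iInter.2 fun m => mem_iUnion.2 ?_
    simp only [mem_ofPred_eq, hG]
    exact ((tendsto_truncatedDist hx m ω).eventually (gt_mem_nhds one_pos)).exists
  · have hne : (comap (stoneCechUnit : Ω → StoneCech Ω) (𝓝 z)).NeBot := by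
      rw [comap_neBot_iff_frequently]
      exact mem_closure_iff_frequently.1 (denseRange_stoneCechUnit z)
    let u : Ultrafilter Ω := Ultrafilter.of (comap stoneCechUnit (𝓝 z))
    have hu : Tendsto stoneCechUnit (u : Filter Ω) (𝓝 z) :=
      tendsto_comap.mono_left (Ultrafilter.of_le _)
    have hcauchy : Cauchy (u : Filter Ω) := by
      refine Metric.cauchy_iff.2 ⟨inferInstance, fun ε hε => ?_⟩
      obtain ⟨m, hm⟩ := exists_nat_one_div_lt (half_pos hε)
      obtain ⟨N, hN⟩ := mem_iUnion.1 (mem_iInter.1 hz m)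
      have hev : ⋃ i ∈ Iic N, Metric.ball (x i) (1 / (m + 1)) ∈ u := by
        have := hu.eventually ((G m N).continuous.continuousAt.eventually (gt_mem_nhds hN))
        filter_upwards [this] with ω hω
        rw [hG] at hω
        obtain ⟨i, hi, hd⟩ := exists_dist_lt_of_truncatedDist_lt_one hω
        exact mem_biUnion (show i ∈ Iic N from hi) hd
      obtain ⟨i, -, hi⟩ := (Ultrafilter.finite_biUnion_mem_iff (finite_Iic N)).1 hev
      refine ⟨_, hi, fun a ha b hb => ?_⟩
      have h1 : dist a (x i) < 1 / (m + 1) := ha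
      have h2 : dist b (x i) < 1 / (m + 1) := hb
      have h3 := dist_triangle_right a b (x i)
      linarith
    obtain ⟨y, hy⟩ := CompleteSpace.complete hcauchy
    exact ⟨y, tendsto_nhds_unique ((continuous_stoneCechUnit.tendsto y).mono_left hy) hu⟩

variable [MeasurableSpace Ω] [BorelSpace Ω]

/-- **Daniell's theorem** on a Polish space: a normalized positive linear functional on `C_b(Ω)`
which is continuous along sequences decreasing to `0` is the expectation of a probability measure.
The functional is represented by a measure on the Stone-Čech compactification, and the continuity
forces this measure to be carried by `Ω`. -/
theorem exists_probabilityMeasure_integral_eq (l : (Ω →ᵇ ℝ) →ₗ[ℝ] ℝ)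
    (hpos : ∀ X, 0 ≤ X → 0 ≤ l X) (hone : l (BoundedContinuousFunction.const Ω 1) = 1)
    (hlim : ∀ X : ℕ → Ω →ᵇ ℝ, Antitone X → (∀ ω, Tendsto (fun n => X n ω) atTop (𝓝 0)) →
      Tendsto (fun n => l (X n)) atTop (𝓝 0)) :
    ∃ Q : ProbabilityMeasure Ω, ∀ X : Ω →ᵇ ℝ, ∫ ω, X ω ∂(Q : Measure Ω) = l X := by
  have hΩ : Nonempty Ω := by
    by_contra h
    rw [not_nonempty_iff] at h
    rw [show BoundedContinuousFunction.const Ω (1 : ℝ) = 0 from by ext ω; exact h.elim ω,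
      map_zero] at hone
    exact zero_ne_one hone
  let : MeasurableSpace (StoneCech Ω) := borel _
  have : BorelSpace (StoneCech Ω) := ⟨rfl⟩
  let ι : Ω → StoneCech Ω := stoneCechUnit
  let R : C(StoneCech Ω, ℝ) → (Ω →ᵇ ℝ) := fun g =>
    (BoundedContinuousFunction.mkOfCompact g).compContinuous ⟨ι, continuous_stoneCechUnit⟩
  let Λ : CompactlySupportedContinuousMap (StoneCech Ω) ℝ →ₚ[ℝ] ℝ :=
    { toFun := fun g => l (R g.toContinuousMap)
      map_add' := fun g h => by rw [← map_add]; rfl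
      map_smul' := fun c g => by rw [RingHom.id_apply, ← map_smul]; rfl
      monotone' := fun g h hgh => by
        rw [← sub_nonneg, ← map_sub]
        exact hpos _ fun ω => sub_nonneg.2 (hgh (ι ω)) }
  let μ : Measure (StoneCech Ω) := RealRMK.rieszMeasure Λ
  have hμ : ∀ (g : C(StoneCech Ω, ℝ)) (X : Ω →ᵇ ℝ), (∀ ω, g (ι ω) = X ω) →
      ∫ z, g z ∂μ = l X := fun g X h => by
    have h1 := RealRMK.integral_rieszMeasure Λ ⟨g, HasCompactSupport.of_compactSpace _⟩
    have h2 : R g = X := by ext ω; exact h ω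
    rw [← h2]
    exact h1
  have : IsFiniteMeasure μ := ⟨isCompact_univ.measure_lt_top⟩
  have : IsProbabilityMeasure μ := by
    have h := hμ (ContinuousMap.const _ 1) _ (fun ω => rfl) |>.trans hone
    simp only [ContinuousMap.const_apply, integral_const, smul_eq_mul, mul_one] at h
    exact ⟨by rw [← ofReal_measureReal, h, ENNReal.ofReal_one]⟩
  obtain ⟨F, hF, hF0, hFpos, hrange⟩ := exists_stoneCech_range_eq (Ω := Ω)
  choose G hG using fun m N => exists_stoneCech_extension (F m N)
  have hS : range ι = ⋂ m, ⋃ N, {z | G m N z < 1} := hrange G hG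
  have hmeas : MeasurableSet (range ι) := by
    rw [hS]
    exact MeasurableSet.iInter fun m => MeasurableSet.iUnion fun N =>
      (isOpen_lt (G m N).continuous continuous_const).measurableSet
  have hι : MeasurableEmbedding ι := isEmbedding_stoneCechUnit.measurableEmbedding hmeas
  have hμι : ∀ᵐ z ∂μ, z ∈ range ι := by
    simp only [hS, mem_iInter, mem_iUnion]
    refine ae_all_iff.2 fun m => ?_
    have hle : ∀ N, μ.real {z | ¬ ∃ N, z ∈ {z | G m N z < 1}} ≤ l (F m N) := fun N => by
      have h0 : ∀ z, 0 ≤ G m N z := fun z =>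
        stoneCech_le_of_le (f := 0) (fun ω => by rw [hG]; exact hFpos m N ω) z
      have h := mul_meas_ge_le_integral_of_nonneg (μ := μ) (Eventually.of_forall h0)
        ((BoundedContinuousFunction.mkOfCompact (G m N)).integrable μ) 1
      rw [one_mul, hμ _ _ (hG m N)] at h
      refine le_trans (measureReal_mono fun z hz => ?_) h
      simp only [mem_ofPred_eq, not_exists, not_lt] at hz ⊢
      exact hz N
    have := ge_of_tendsto' (hlim _ (hF m) (hF0 m)) hle
    exact (measureReal_eq_zero_iff).1 (le_antisymm this measureReal_nonneg)
  have hmap : (μ.comap ι).map ι = μ := by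
    rw [hι.map_comap]
    exact Measure.restrict_eq_self_of_ae_mem hμι
  have hprob : IsProbabilityMeasure (μ.comap ι) :=
    ⟨by rw [← preimage_univ (f := ι), ← Measure.map_apply hι.measurable .univ, hmap, measure_univ]⟩
  refine ⟨⟨μ.comap ι, hprob⟩, fun X => ?_⟩
  obtain ⟨g, hg⟩ := exists_stoneCech_extension X
  calc ∫ ω, X ω ∂(μ.comap ι) = ∫ ω, g (ι ω) ∂(μ.comap ι) := by simp only [ι, hg]
    _ = ∫ z, g z ∂((μ.comap ι).map ι) := (hι.integral_map _).symm
    _ = l X := by rw [hmap, hμ g X hg]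

end RiskMeasure

namespace RiskMeasure

/-! ### Subgradients -/

section

variable {Ω : Type*} [TopologicalSpace Ω] {ρ : (Ω →ᵇ ℝ) → ℝ}

/-- The one-sided directional derivative of the convex function `ρ` at `X` in the direction `Z`,
as an infimum of difference quotients. These are bounded below by `-‖Z‖` when `ρ` is a convex risk
measure. -/
noncomputable def directionalDeriv (ρ : (Ω →ᵇ ℝ) → ℝ) (X Z : Ω →ᵇ ℝ) : ℝ :=
  ⨅ t : Ioi (0 : ℝ), (ρ (X + (t : ℝ) • Z) - ρ X) / (t : ℝ)

namespace IsConvexRiskMeasureOn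

variable (hρ : IsConvexRiskMeasureOn ⊤ ρ)
include hρ

lemma directionalDeriv_le (X Z : Ω →ᵇ ℝ) {t : ℝ} (ht : 0 < t) :
    directionalDeriv ρ X Z ≤ (ρ (X + t • Z) - ρ X) / t := by
  refine ciInf_le (f := fun t : Ioi (0 : ℝ) => (ρ (X + (t : ℝ) • Z) - ρ X) / (t : ℝ))
    ⟨-‖Z‖, ?_⟩ ⟨t, ht⟩
  rintro _ ⟨s, rfl⟩
  have hs : (0 : ℝ) < s := s.2
  have h := hρ.abs_sub_le_norm const_mem_top (X := X + (s : ℝ) • Z) (Y := X) trivial trivial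
  rw [add_sub_cancel_left, norm_smul, Real.norm_of_nonneg hs.le] at h
  have h' := (abs_le.1 h).1
  dsimp only
  rw [le_div_iff₀ hs]
  linarith

lemma directionalDeriv_smul_le (X Z : Ω →ᵇ ℝ) {c : ℝ} (hc : 0 < c) :
    directionalDeriv ρ X (c • Z) ≤ c * directionalDeriv ρ X Z := by
  have : Nonempty (Ioi (0 : ℝ)) := nonempty_Ioi.to_subtype
  rw [← div_le_iff₀' hc]
  refine le_ciInf fun t => ?_
  have ht : (0 : ℝ) < t := t.2
  have h := hρ.directionalDeriv_le X (c • Z) (t := t / c) (by positivity)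
  rw [smul_smul, div_mul_cancel₀ _ hc.ne'] at h
  rw [div_le_iff₀' hc]
  refine h.trans_eq ?_
  field_simp

lemma directionalDeriv_smul (X Z : Ω →ᵇ ℝ) {c : ℝ} (hc : 0 < c) :
    directionalDeriv ρ X (c • Z) = c * directionalDeriv ρ X Z := by
  refine (hρ.directionalDeriv_smul_le X Z hc).antisymm ?_
  have h := hρ.directionalDeriv_smul_le X (c • Z) (inv_pos.2 hc)
  rwa [inv_smul_smul₀ hc.ne', ← div_eq_inv_mul, le_div_iff₀' hc] at h

lemma directionalDeriv_add_le (X Z W : Ω →ᵇ ℝ) :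
    directionalDeriv ρ X (Z + W) ≤ directionalDeriv ρ X Z + directionalDeriv ρ X W := by
  have : Nonempty (Ioi (0 : ℝ)) := nonempty_Ioi.to_subtype
  refine le_ciInf_add_ciInf fun s t => ?_
  obtain ⟨s, hs⟩ := s
  obtain ⟨t, ht⟩ := t
  have hs' : 0 < s := hs
  have ht' : 0 < t := ht
  -- The step `r` with `r⁻¹ = s⁻¹ + t⁻¹` makes `X + r (Z + W)` a convex combination of
  -- `X + s Z` and `X + t W`.
  have h1 := hρ.directionalDeriv_le X (Z + W) (t := s * t / (s + t)) (by positivity)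
  have h2 := hρ.convex (X + s • Z) trivial (X + t • W) trivial (t / (s + t)) (by positivity)
    ((div_le_one (by positivity)).2 (by linarith))
  have h3 : (t / (s + t)) • (X + s • Z) + (1 - t / (s + t)) • (X + t • W)
      = X + (s * t / (s + t)) • (Z + W) := by
    ext x
    change t / (s + t) * (X x + s * Z x) + (1 - t / (s + t)) * (X x + t * W x)
      = X x + s * t / (s + t) * (Z x + W x)
    field_simp
    ring
  rw [h3] at h2
  refine h1.trans ?_
  rw [div_le_iff₀ (by positivity)]
  refine (sub_le_sub_right h2 _).trans_eq ?_
  field_simp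
  ring

/-- Hahn–Banach: a convex risk measure has a subgradient at every point, and the subgradient is
dominated by the sublinear majorant. -/
lemma exists_subgradient (h0 : ρ 0 = 0) (X : Ω →ᵇ ℝ) :
    ∃ l : (Ω →ᵇ ℝ) →ₗ[ℝ] ℝ, (∀ Z, l Z ≤ rhoMin ρ Z) ∧ ∀ Y, l Y - ρ Y ≤ l X - ρ X := by
  have hzero : directionalDeriv ρ X 0 = 0 := by
    have : Nonempty (Ioi (0 : ℝ)) := nonempty_Ioi.to_subtype
    simp [directionalDeriv]
  obtain ⟨l, -, hl⟩ := exists_extension_of_le_sublinear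
    (⟨⊥, 0⟩ : (Ω →ᵇ ℝ) →ₗ.[ℝ] ℝ) (directionalDeriv ρ X)
    (fun c hc Z => hρ.directionalDeriv_smul X Z hc) (hρ.directionalDeriv_add_le X)
    fun Z => by
      have hZ : (Z : Ω →ᵇ ℝ) = 0 := (Submodule.mem_bot ℝ).1 Z.2
      rw [hZ, hzero]
      exact le_rfl
  have hl1 : ∀ Z, l Z ≤ ρ (X + Z) - ρ X := fun Z => by
    have h := (hl Z).trans (hρ.directionalDeriv_le X Z one_pos)
    rwa [one_smul, div_one] at h
  refine ⟨l, fun Z => ?_, fun Y => ?_⟩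
  · have h1 := hl1 Z
    have h2 := hρ.apply_add_le const_mem_top h0 (X := X) (Z := Z) trivial trivial
    linarith
  · have h := hl1 (Y - X)
    rw [add_sub_cancel, map_sub] at h
    linarith

end IsConvexRiskMeasureOn

end

/-! ### Dual representation -/

variable {Ω : Type*} [TopologicalSpace Ω] [PolishSpace Ω] [MeasurableSpace Ω] [BorelSpace Ω]
  {ρ : (Ω →ᵇ ℝ) → ℝ}

/-- The probability measures dominated by the sublinear majorant of `ρ`. -/
def dominatedMeasures (ρ : (Ω →ᵇ ℝ) → ℝ) : Set (ProbabilityMeasure Ω) :=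
  {Q | ∀ X : Ω →ᵇ ℝ, ∫ ω, -X ω ∂(Q : Measure Ω) ≤ rhoMin ρ X}

omit [PolishSpace Ω] in
lemma continuous_integral_neg (X : Ω →ᵇ ℝ) :
    Continuous fun Q : ProbabilityMeasure Ω => ∫ ω, -X ω ∂(Q : Measure Ω) :=
  ProbabilityMeasure.continuous_integral_boundedContinuousFunction (-X)

omit [PolishSpace Ω] [BorelSpace Ω] in
lemma le_penalty (Q : ProbabilityMeasure Ω) (X : Ω →ᵇ ℝ) :
    ((∫ ω, -X ω ∂(Q : Measure Ω) - ρ X : ℝ) : EReal) ≤ penalty ρ Q :=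
  le_iSup (fun X : Ω →ᵇ ℝ => ((∫ ω, -X ω ∂(Q : Measure Ω) - ρ X : ℝ) : EReal)) X

omit [PolishSpace Ω] [BorelSpace Ω] in
lemma penalty_eq_of_forall_le {Q : ProbabilityMeasure Ω} {X : Ω →ᵇ ℝ}
    (h : ∀ Y : Ω →ᵇ ℝ,
      ∫ ω, -Y ω ∂(Q : Measure Ω) - ρ Y ≤ ∫ ω, -X ω ∂(Q : Measure Ω) - ρ X) :
    penalty ρ Q = ((∫ ω, -X ω ∂(Q : Measure Ω) - ρ X : ℝ) : EReal) :=
  (iSup_le fun Y => EReal.coe_le_coe_iff.2 (h Y)).antisymm (le_penalty Q X)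

section

variable (hρ : IsConvexRiskMeasureOn ⊤ ρ) (h0 : ρ 0 = 0) (hreg : IsUniformlyRegularOn ⊤ ρ)
include hρ h0 hreg

/-- By uniform regularity, a linear functional dominated by the sublinear majorant satisfies the
hypotheses of Daniell's theorem, up to sign. -/
lemma exists_measure_of_le_rhoMin (l : (Ω →ᵇ ℝ) →ₗ[ℝ] ℝ) (hl : ∀ X, l X ≤ rhoMin ρ X) :
    ∃ Q ∈ dominatedMeasures ρ, ∀ X : Ω →ᵇ ℝ, ∫ ω, -X ω ∂(Q : Measure Ω) = l X := by
  have hconst : ∀ a : ℝ, rhoMin ρ (BoundedContinuousFunction.const Ω a) = -a := fun a => by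
    have : Nonempty (Ioi (0 : ℝ)) := nonempty_Ioi.to_subtype
    have h : ∀ t : Ioi (0 : ℝ),
        ρ ((t : ℝ) • BoundedContinuousFunction.const Ω a) / (t : ℝ) = -a := fun t => by
      have ht : (t : ℝ) ≠ 0 := (show (0 : ℝ) < t from t.2).ne'
      have h := hρ.translation 0 trivial (t * a)
      rw [zero_add, h0, zero_sub] at h
      rw [show (t : ℝ) • BoundedContinuousFunction.const Ω a
        = BoundedContinuousFunction.const Ω (t * a) from rfl, h]
      field_simp
    simp only [rhoMin, h, ciSup_const]
  have hpos : ∀ X, 0 ≤ X → 0 ≤ (-l) X := fun X hX => by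
    have h := (hl X).trans (hρ.rhoMin_antitone const_mem_top h0 (X := 0) trivial trivial hX)
    rw [IsConvexRiskMeasureOn.rhoMin_zero h0] at h
    rw [LinearMap.neg_apply]
    linarith
  have hone : (-l) (BoundedContinuousFunction.const Ω 1) = 1 := by
    have h1 := hl (BoundedContinuousFunction.const Ω 1)
    have h2 := hl (BoundedContinuousFunction.const Ω (-1))
    rw [hconst] at h1 h2
    rw [show BoundedContinuousFunction.const Ω (-1 : ℝ) = -BoundedContinuousFunction.const Ω 1
      from rfl, map_neg] at h2
    rw [LinearMap.neg_apply]
    linarith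
  obtain ⟨Q, hQ⟩ := exists_probabilityMeasure_integral_eq (-l) hpos hone fun X hX hlim => by
    have hX0 : ∀ n, 0 ≤ X n := fun n ω =>
      le_of_tendsto (hlim ω) ((eventually_ge_atTop n).mono fun m hm => hX hm ω)
    refine squeeze_zero (fun n => hpos _ (hX0 n)) (fun n => ?_)
      (hreg.tendsto_rhoMin hρ const_mem_top h0 (fun _ => trivial) hX hlim)
    rw [LinearMap.neg_apply, ← map_neg]
    exact hl _
  have h : ∀ X : Ω →ᵇ ℝ, ∫ ω, -X ω ∂(Q : Measure Ω) = l X := fun X => by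
    rw [integral_neg, hQ, LinearMap.neg_apply, neg_neg]
  exact ⟨Q, fun X => (h X).trans_le (hl X), h⟩

/-- The dominated measures form a weakly compact set: the limit of the expectations along an
ultrafilter is again represented by a measure. -/
lemma isCompact_dominatedMeasures : IsCompact (dominatedMeasures ρ) := by
  refine isCompact_iff_ultrafilter_le_nhds'.2 fun u hu => ?_
  have hlim : ∀ X : Ω →ᵇ ℝ, ∃ a : ℝ,
      Tendsto (fun Q : ProbabilityMeasure Ω => ∫ ω, -X ω ∂(Q : Measure Ω)) u (𝓝 a) := fun X => by
    obtain ⟨a, -, ha⟩ := (isCompact_closedBall (0 : ℝ) ‖X‖).ultrafilter_le_nhds'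
      (u.map fun Q : ProbabilityMeasure Ω => ∫ ω, -X ω ∂(Q : Measure Ω))
      (Filter.mem_map.2 (Eventually.of_forall fun Q => by
        have h := (-X).norm_integral_le_norm (Q : Measure Ω)
        rw [norm_neg] at h
        exact mem_closedBall_zero_iff.2 h))
    exact ⟨a, ha⟩
  choose a ha using hlim
  have hint : ∀ (Q : ProbabilityMeasure Ω) (X : Ω →ᵇ ℝ), Integrable X (Q : Measure Ω) :=
    fun Q X => X.integrable _
  let l : (Ω →ᵇ ℝ) →ₗ[ℝ] ℝ :=
    { toFun := a
      map_add' := fun X Y => by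
        refine tendsto_nhds_unique (ha (X + Y)) (((ha X).add (ha Y)).congr fun Q => ?_)
        refine (integral_add (hint Q X).neg (hint Q Y).neg).symm.trans ?_
        exact integral_congr_ae (Eventually.of_forall fun ω => (neg_add (X ω) (Y ω)).symm)
      map_smul' := fun c X => by
        refine tendsto_nhds_unique (ha (c • X)) (((ha X).const_mul c).congr fun Q => ?_)
        rw [← integral_const_mul]
        exact integral_congr_ae (Eventually.of_forall fun ω => mul_neg c (X ω)) }
  obtain ⟨Q, hQ, hQl⟩ := exists_measure_of_le_rhoMin hρ h0 hreg l fun X =>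
    le_of_tendsto (ha X) (Filter.mem_of_superset hu fun Q hQ => hQ X)
  refine ⟨Q, hQ, ?_⟩
  change Tendsto id (u : Filter (ProbabilityMeasure Ω)) (𝓝 Q)
  refine ProbabilityMeasure.tendsto_iff_forall_integral_tendsto.2 fun X => ?_
  have h := (ha X).neg
  rw [show a X = l X from rfl, ← hQl X] at h
  simpa only [integral_neg, neg_neg, id_eq] using h

/-- The supremum defining the penalty of a suitable dominated measure is attained at `X`, so that
the dual representation of `ρ X` is attained as well. -/
lemma exists_dominated_maximizer (X : Ω →ᵇ ℝ) :
    ∃ Q ∈ dominatedMeasures ρ, ∀ Y : Ω →ᵇ ℝ,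
      ∫ ω, -Y ω ∂(Q : Measure Ω) - ρ Y ≤ ∫ ω, -X ω ∂(Q : Measure Ω) - ρ X := by
  obtain ⟨l, hl, hlX⟩ := hρ.exists_subgradient h0 X
  obtain ⟨Q, hQ, hQl⟩ := exists_measure_of_le_rhoMin hρ h0 hreg l hl
  exact ⟨Q, hQ, fun Y => by simpa only [hQl] using hlX Y⟩

/-- A countable dense subset of the graph of the penalty over the dominated measures represents
`ρ`. Density is needed in the graph, since the penalty is only lower semicontinuous. -/
lemma exists_representing_sequence :
    ∃ (Q : ℕ → ProbabilityMeasure Ω) (a : ℕ → ℝ), (∀ n, Q n ∈ dominatedMeasures ρ) ∧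
      (∀ n, penalty ρ (Q n) = a n) ∧
      ∀ X : Ω →ᵇ ℝ, ∀ r < ρ X, ∃ n, r < ∫ ω, -X ω ∂(Q n : Measure Ω) - a n := by
  let := TopologicalSpace.pseudoMetrizableSpacePseudoMetric (ProbabilityMeasure Ω)
  let G : Set (ProbabilityMeasure Ω × ℝ) :=
    {p | p.1 ∈ dominatedMeasures ρ ∧ penalty ρ p.1 = p.2}
  have hsep : TopologicalSpace.IsSeparable G :=
    ((isCompact_dominatedMeasures hρ h0 hreg).isSeparable.prod
      (TopologicalSpace.IsSeparable.of_separableSpace (univ : Set ℝ))).mono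
      fun p hp => ⟨hp.1, trivial⟩
  obtain ⟨T, hTG, hTc, hGT⟩ := hsep.exists_countable_dense_subset
  have hG : ∀ X : Ω →ᵇ ℝ, ∃ p ∈ G, ∫ ω, -X ω ∂(p.1 : Measure Ω) - p.2 = ρ X := fun X => by
    obtain ⟨Q, hQ, hQX⟩ := exists_dominated_maximizer hρ h0 hreg X
    exact ⟨(Q, _), ⟨hQ, penalty_eq_of_forall_le hQX⟩, sub_sub_cancel _ _⟩
  have hT : T.Nonempty := by
    obtain ⟨p, hp, -⟩ := hG 0
    exact closure_nonempty_iff.1 ⟨p, hGT hp⟩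
  obtain ⟨g, hg⟩ := hTc.exists_eq_range hT
  have hgG : ∀ n, g n ∈ G := fun n => hTG (hg ▸ mem_range_self n)
  refine ⟨fun n => (g n).1, fun n => (g n).2, fun n => (hgG n).1, fun n => (hgG n).2,
    fun X r hr => ?_⟩
  obtain ⟨p, hp, hpX⟩ := hG X
  have hopen : IsOpen {p : ProbabilityMeasure Ω × ℝ |
      r < ∫ ω, -X ω ∂(p.1 : Measure Ω) - p.2} :=
    isOpen_lt continuous_const
      (((continuous_integral_neg X).comp continuous_fst).sub continuous_snd)
  obtain ⟨q, hq, hqT⟩ := mem_closure_iff.1 (hGT hp) _ hopen (hr.trans_eq hpX.symm)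
  obtain ⟨n, rfl⟩ := (hg ▸ hqT : q ∈ range g)
  exact ⟨n, hq⟩

end

section

variable {Q : ℕ → ProbabilityMeasure Ω} {a : ℕ → ℝ} (hpen : ∀ n, penalty ρ (Q n) = a n)
  (hrep : ∀ X : Ω →ᵇ ℝ, ∀ r < ρ X, ∃ n, r < ∫ ω, -X ω ∂(Q n : Measure Ω) - a n)
include hpen

omit [PolishSpace Ω] [BorelSpace Ω] in
lemma integral_neg_sub_le (n : ℕ) (X : Ω →ᵇ ℝ) :
    ∫ ω, -X ω ∂(Q n : Measure Ω) - a n ≤ ρ X := by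
  have h := le_penalty (ρ := ρ) (Q n) X
  rw [hpen, EReal.coe_le_coe_iff] at h
  linarith

include hrep

omit [PolishSpace Ω] [BorelSpace Ω] in
lemma eq_iSup_of_representing_sequence (X : Ω →ᵇ ℝ) :
    (ρ X : EReal) =
      ⨆ n, ((∫ ω, -X ω ∂(Q n : Measure Ω) : ℝ) : EReal) - penalty ρ (Q n) := by
  simp only [hpen, ← EReal.coe_sub]
  refine le_antisymm (le_of_forall_lt fun c hc => ?_)
    (iSup_le fun n => EReal.coe_le_coe_iff.2 (integral_neg_sub_le hpen n X))
  obtain ⟨r, hcr, hr⟩ := EReal.lt_iff_exists_real_btwn.1 hc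
  obtain ⟨n, hn⟩ := hrep X r (EReal.coe_lt_coe_iff.1 hr)
  exact (hcr.trans (EReal.coe_lt_coe_iff.2 hn)).trans_le
    (le_iSup (fun n => ((∫ ω, -X ω ∂(Q n : Measure Ω) - a n : ℝ) : EReal)) n)

/-- Maximizing sequences have cluster points, and the penalty is lower semicontinuous, so the
supremum in the representation is attained on the closure. -/
lemma exists_mem_closure_eq (hcomp : IsCompact (closure (range Q))) (X : Ω →ᵇ ℝ) :
    ∃ QX ∈ closure (range Q), (ρ X : EReal) =
      ((∫ ω, -X ω ∂(QX : Measure Ω) : ℝ) : EReal) - penalty ρ QX := by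
  have hex : ∀ k : ℕ, ∃ n, ρ X - 1 / (k + 1) < ∫ ω, -X ω ∂(Q n : Measure Ω) - a n := fun k =>
    hrep X _ (sub_lt_self _ (by positivity))
  choose n hn using hex
  obtain ⟨QX, hQX, φ, hφ, hlim⟩ :=
    hcomp.tendsto_subseq fun k => subset_closure (mem_range_self (n k))
  have hmax : ∀ Y : Ω →ᵇ ℝ,
      ∫ ω, -Y ω ∂(QX : Measure Ω) - ρ Y ≤ ∫ ω, -X ω ∂(QX : Measure Ω) - ρ X := fun Y => by
    have hY := (((continuous_integral_neg Y).tendsto QX).comp hlim).sub_const (ρ Y)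
    have hX := (((continuous_integral_neg X).tendsto QX).comp hlim).sub_const (ρ X)
    have hX' := hX.add ((tendsto_one_div_add_atTop_nhds_zero_nat (𝕜 := ℝ)).comp hφ.tendsto_atTop)
    rw [add_zero] at hX'
    refine le_of_tendsto_of_tendsto' hY hX' fun k => ?_
    have h1 := integral_neg_sub_le hpen (n (φ k)) Y
    have h2 := hn (φ k)
    simp only [Function.comp_apply]
    linarith
  refine ⟨QX, hQX, ?_⟩
  rw [penalty_eq_of_forall_le hmax, ← EReal.coe_sub, sub_sub_cancel]

omit [PolishSpace Ω] in
lemma isRiskless_iff_forall_ae (hmono : ∀ X Y : Ω →ᵇ ℝ, X ≤ Y → ρ Y ≤ ρ X) (h0 : ρ 0 = 0)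
    {X : Ω →ᵇ ℝ} (hX : X ≤ 0) :
    IsRiskless ρ X ↔ ∀ n, ∀ᵐ ω ∂(Q n : Measure Ω), X ω = 0 := by
  have ha : ∀ n, 0 ≤ a n := fun n => by
    have h := integral_neg_sub_le hpen n 0
    simp only [h0, BoundedContinuousFunction.coe_zero, Pi.zero_apply, neg_zero, integral_zero]
      at h
    linarith
  have hsmul : ∀ n (t : ℝ), ∫ ω, -(t • X) ω ∂(Q n : Measure Ω)
      = t * ∫ ω, -X ω ∂(Q n : Measure Ω) := fun n t => by
    rw [← integral_const_mul]
    exact integral_congr_ae (Eventually.of_forall fun ω => (mul_neg t (X ω)).symm)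
  have hnonneg : ∀ ω, 0 ≤ -X ω := fun ω => neg_nonneg.2 (hX ω)
  constructor
  · rintro ⟨-, h⟩ n
    have hle : ∀ t : ℝ, 0 < t → t * ∫ ω, -X ω ∂(Q n : Measure Ω) ≤ a n := fun t ht => by
      have h1 := integral_neg_sub_le hpen n (t • X)
      rw [hsmul, h t ht] at h1
      linarith
    have hI : ∫ ω, -X ω ∂(Q n : Measure Ω) = 0 := by
      refine le_antisymm ?_ (integral_nonneg hnonneg)
      by_contra! hpos
      -- At `t = (a n + 1) / I` the bound `t * I ≤ a n` is violated.
      have h1 := hle ((a n + 1) / ∫ ω, -X ω ∂(Q n : Measure Ω))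
        (div_pos (by linarith [ha n]) hpos)
      rw [div_mul_cancel₀ _ hpos.ne'] at h1
      linarith
    have h1 := (integral_eq_zero_iff_of_nonneg hnonneg (X.integrable _).neg).1 hI
    filter_upwards [h1] with ω hω
    exact neg_eq_zero.1 hω
  · refine fun h => ⟨hX, fun t ht => le_antisymm ?_ ?_⟩
    · by_contra! hpos
      obtain ⟨n, hn⟩ := hrep _ 0 hpos
      have hI : ∫ ω, -X ω ∂(Q n : Measure Ω) = 0 :=
        integral_eq_zero_of_ae ((h n).mono fun ω hω => by simp [hω])
      rw [hsmul, hI] at hn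
      linarith [ha n]
    · rw [← h0]
      exact hmono _ _ fun ω => mul_nonpos_of_nonneg_of_nonpos ht.le (hX ω)

end

omit [TopologicalSpace Ω] [PolishSpace Ω] [BorelSpace Ω] in
lemma isProbabilityMeasure_mixture {a : ℕ → ℝ≥0} (ha : HasSum a 1)
    (Q : ℕ → ProbabilityMeasure Ω) : IsProbabilityMeasure (mixture a Q) := by
  constructor
  rw [mixture, Measure.sum_apply _ MeasurableSet.univ]
  simp only [Measure.smul_apply, measure_univ, ENNReal.smul_def, smul_eq_mul, mul_one]
  rw [← ENNReal.coe_tsum ha.summable, ha.tsum_eq, ENNReal.coe_one]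

omit [TopologicalSpace Ω] [PolishSpace Ω] [BorelSpace Ω] in
lemma ae_mixture_iff {a : ℕ → ℝ≥0} (ha : ∀ n, 0 < a n) (Q : ℕ → ProbabilityMeasure Ω)
    {p : Ω → Prop} :
    (∀ᵐ ω ∂(mixture a Q), p ω) ↔ ∀ n, ∀ᵐ ω ∂(Q n : Measure Ω), p ω := by
  rw [mixture, ae_iff, Measure.sum_apply_eq_zero]
  refine forall_congr' fun n => ?_
  rw [ae_iff, Measure.smul_apply, ENNReal.smul_def, smul_eq_mul, mul_eq_zero, or_iff_right]
  exact ENNReal.coe_ne_zero.2 (ha n).ne'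

end RiskMeasure

theorem mainTheorem1 {Ω : Type*} [TopologicalSpace Ω] [PolishSpace Ω] [MeasurableSpace Ω]
    [BorelSpace Ω] (L : Submodule ℝ (Ω →ᵇ ℝ)) (hL : RiskMeasure.IsGeneratingLattice L)
    (ρ : (Ω →ᵇ ℝ) → ℝ) (hρ : RiskMeasure.IsConvexRiskMeasureOn L ρ) (hρ0 : ρ 0 = 0)
    (hreg : RiskMeasure.IsUniformlyRegularOn L ρ) :
    ∃ ρ' : (Ω →ᵇ ℝ) → ℝ,
      -- `ρ'` is a convex risk measure on `C_b(Ω)` extending `ρ`, again uniformly regular,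
      -- and continuous for the semi-norm `c_ρ`
      RiskMeasure.IsConvexRiskMeasureOn ⊤ ρ' ∧ Set.EqOn ρ' ρ L ∧
      RiskMeasure.IsUniformlyRegularOn ⊤ ρ' ∧
      RiskMeasure.ContinuousFor (RiskMeasure.capacity L ρ) ρ' ∧
      -- it is the only extension that is a convex risk measure
      (∀ σ : (Ω →ᵇ ℝ) → ℝ, RiskMeasure.IsConvexRiskMeasureOn ⊤ σ → Set.EqOn σ ρ L → σ = ρ') ∧
      -- and the only extension that is continuous for the semi-norm `c_ρ`
      (∀ σ : (Ω →ᵇ ℝ) → ℝ, RiskMeasure.ContinuousFor (RiskMeasure.capacity L ρ) σ →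
        Set.EqOn σ ρ L → σ = ρ') ∧
      ∃ Q : ℕ → ProbabilityMeasure Ω,
        IsCompact (closure (Set.range Q)) ∧
        (∀ n, RiskMeasure.penalty ρ' (Q n) < ⊤) ∧
        (∀ X : Ω →ᵇ ℝ, (ρ' X : EReal) =
          ⨆ n, ((∫ ω, -X ω ∂(Q n : Measure Ω) : ℝ) : EReal) - RiskMeasure.penalty ρ' (Q n)) ∧
        (∀ a : ℕ → ℝ≥0, (∀ n, 0 < a n) → HasSum a 1 →
          IsProbabilityMeasure (RiskMeasure.mixture a Q) ∧
          ∀ X : Ω →ᵇ ℝ, X ≤ 0 →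
            (RiskMeasure.IsRiskless ρ' X ↔ ∀ᵐ ω ∂(RiskMeasure.mixture a Q), X ω = 0)) ∧
        (∀ X : Ω →ᵇ ℝ, ∃ QX ∈ closure (Set.range Q), (ρ' X : EReal) =
          ((∫ ω, -X ω ∂(QX : Measure Ω) : ℝ) : EReal) - RiskMeasure.penalty ρ' QX) := by

  have hc := hL.const_mem
  have hρ' := RiskMeasure.isConvexRiskMeasureOn_extension hρ hc
  have h0' := RiskMeasure.extension_zero hL hρ hρ0
  have hext := RiskMeasure.extension_eqOn hρ hc
  have hreg' := RiskMeasure.isUniformlyRegularOn_extension hL hρ hρ0 hreg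
  have hcont := RiskMeasure.continuousFor_extension hL hρ hρ0 hreg
  obtain ⟨Q, a, hQ, hpen, hrep⟩ := RiskMeasure.exists_representing_sequence hρ' h0' hreg'
  have hcomp : IsCompact (closure (Set.range Q)) :=
    (RiskMeasure.isCompact_dominatedMeasures hρ' h0' hreg').closure_of_subset
      (Set.range_subset_iff.2 hQ)
  refine ⟨RiskMeasure.extension L ρ, hρ', hext, hreg', hcont,
    fun σ hσ hσL => RiskMeasure.eq_of_isConvexRiskMeasureOn hL hρ hρ0 hreg hσ hρ' hσL hext,
    fun σ hσ hσL => RiskMeasure.eq_of_continuousFor hL hρ hρ0 hreg hσ hcont hσL hext,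
    Q, hcomp, fun n => hpen n ▸ EReal.coe_lt_top _,
    RiskMeasure.eq_iSup_of_representing_sequence hpen hrep,
    fun b hb hsum => ⟨RiskMeasure.isProbabilityMeasure_mixture hsum Q, fun X hX => ?_⟩,
    RiskMeasure.exists_mem_closure_eq hpen hrep hcomp⟩
  rw [RiskMeasure.ae_mixture_iff hb, RiskMeasure.isRiskless_iff_forall_ae hpen hrep
    (fun X Y h => hρ'.monotonic X trivial Y trivial h) h0' hX]
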